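/- Let $\Gamma$ be a finite group and let $\sigma\in\Gamma$ be a central element of order two. Then there exist $d\in\mathbb{N}$ and a convex polytope $P\subset\mathbb{R}^d$ (the convex hull of a nonempty finite set of points) that is centrally symmetric about the origin, $P=-P$, such that $$G(P)=\Gamma(P)\cong\Gamma,$$ where $G(P)$ is the group of all Euclidean isometries of $\mathbb{R}^d$ that map $P$ onto itself, $\Gamma(P)$ is the group of all automorphisms of the face lattice of $P$, and $G(P)=\Gamma(P)$ means that the natural homomorphism $G(P)\to\Gamma(P)$, $g\mapsto (F\mapsto g(F))$, is an isomorphism. Moreover, the isomorphism $\Gamma\cong G(P)$ can be chosen so that $\sigma$ corresponds to the central symmetry $x\mapsto -x$. -/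

import Mathlib

section Polytope

variable {E : Type*} [NormedAddCommGroup E] [NormedSpace ℝ E]

/-- A convex polytope: the convex hull of a nonempty finite set of points. -/
def IsConvexPolytope (P : Set E) : Prop :=
  ∃ V : Set E, V.Finite ∧ V.Nonempty ∧ P = convexHull ℝ V

/-- A set is centrally symmetric (about the origin) if it equals its image under `x ↦ -x`. -/
def IsCentrallySymmetric (P : Set E) : Prop :=
  (fun x : E => -x) '' P = P

/-- The faces of `P`: the empty set, and the sets of points of `P` at which some linear functional
attains its maximum over `P` (the zero functional gives `P` itself). They are ordered by
inclusion; for a polytope this is the face lattice. -/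
abbrev FaceLattice (P : Set E) : Type _ :=
  {F : Set E // IsExposed ℝ P F}

/-- The combinatorial symmetry group: all automorphisms of the face lattice. -/
abbrev CombSymmetry (P : Set E) : Type _ :=
  FaceLattice P ≃o FaceLattice P

/-- The geometric symmetry group: all isometries of the ambient space that map `P` onto itself. -/
def geomSymmetry (P : Set E) : Subgroup (E ≃ᵢ E) where
  carrier := {g | g '' P = P}
  one_mem' := by
    change (fun x : E => x) '' P = P
    simp
  mul_mem' := by
    intro a b ha hb
    change (fun x : E => a (b x)) '' P = P
    have ha' : a '' P = P := ha
    have hb' : b '' P = P := hb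
    rw [← Set.image_image a b, hb', ha']
  inv_mem' := by
    intro a ha
    change a.symm '' P = P
    have ha' : a '' P = P := ha
    conv_lhs => rw [← ha']
    rw [Set.image_image]
    simp

/-- A geometric symmetry maps faces to faces. -/
theorem isExposed_image_of_mem_geomSymmetry {P : Set E} {g : E ≃ᵢ E} (hg : g ∈ geomSymmetry P)
    {F : Set E} (hF : IsExposed ℝ P F) : IsExposed ℝ P (g '' F) := by
  have hgP : g '' P = P := hg
  intro hne
  obtain ⟨l, hl⟩ := hF (Set.image_nonempty.mp hne)
  let L := (g.toRealAffineIsometryEquiv).linearIsometryEquiv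
  let l' : E →L[ℝ] ℝ := l.comp (L.symm.toContinuousLinearEquiv : E →L[ℝ] E)
  have key : ∀ x, l' (g x) = l x + l' (g 0) := by
    intro x
    have h : g x = L x + g 0 := by
      have := (g.toRealAffineIsometryEquiv).map_vadd 0 x
      simpa using this
    rw [h, map_add]
    simp [l']
  refine ⟨l', ?_⟩
  ext y
  constructor
  · rintro ⟨x, hx, rfl⟩
    rw [hl] at hx
    refine ⟨hgP ▸ Set.mem_image_of_mem g hx.1, fun z hz => ?_⟩
    rw [← hgP] at hz
    obtain ⟨w, hw, rfl⟩ := hz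
    rw [key w, key x]
    linarith [hx.2 w hw]
  · rintro ⟨hy, hmax⟩
    rw [← hgP] at hy
    obtain ⟨x, hx, rfl⟩ := hy
    refine ⟨x, ?_, rfl⟩
    rw [hl]
    refine ⟨hx, fun w hw => ?_⟩
    have := hmax (g w) (hgP ▸ Set.mem_image_of_mem g hw)
    rw [key w, key x] at this
    linarith

/-- The natural action of the geometric symmetry group on the face lattice, `F ↦ g(F)`, as a
homomorphism from the geometric to the combinatorial symmetry group. -/
def geomToComb (P : Set E) : geomSymmetry P →* CombSymmetry P where
  toFun g :=
    { toFun := fun F => ⟨g.1 '' F.1, isExposed_image_of_mem_geomSymmetry g.2 F.2⟩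
      invFun := fun F => ⟨g⁻¹.1 '' F.1, isExposed_image_of_mem_geomSymmetry g⁻¹.2 F.2⟩
      left_inv := by
        intro F
        apply Subtype.ext
        change g.1.symm '' (g.1 '' F.1) = F.1
        rw [Set.image_image]
        simp
      right_inv := by
        intro F
        apply Subtype.ext
        change g.1 '' (g.1.symm '' F.1) = F.1
        rw [Set.image_image]
        simp
      map_rel_iff' := by
        intro F F'
        exact Set.image_subset_image_iff g.1.injective }
  map_one' := by
    refine RelIso.ext fun F => Subtype.ext ?_
    change (fun x : E => x) '' F.1 = F.1
    simp
  map_mul' := by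
    intro a b
    refine RelIso.ext fun F => Subtype.ext ?_
    change (fun x : E => a.1 (b.1 x)) '' F.1 = a.1 '' (b.1 '' F.1)
    rw [Set.image_image]

end Polytope

/-!
Lattice automorphisms are controlled through the *stacked cross-polytope*: given a set `S` of sign
vectors in dimension `N`, that is, of facets of the cross-polytope, place a low pyramid over every
facet in `S`. All the given points are vertices of the resulting polytope, so an automorphism of the
face lattice permutes them, is determined by this permutation, and preserves the relation of lying
in a common proper face (`Cofacial`). Linear functionals determine this relation: two vertices of
the cross-polytope are cofacial unless they are opposite, an apex is cofacial with exactly the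
vertices of its own facet, and different apexes are never cofacial. Hence the vertices cofacial with
an apex are pairwise cofacial, which fails for the vertices of the cross-polytope; the two kinds
cannot be exchanged, and every automorphism comes from a signed permutation of the coordinates that
preserves `S` (`exists_signedPerm`). Such signed permutations are isometries.

What remains is to let `Γ` act by signed permutations, with `σ` acting as `-1`, and to find an `S`
whose stabilizer in the group of all signed permutations is `Γ`. The signed indices are modelled on
`Γ × {odd functions Γ → ±1} × Fin 13`, with the all-ones sign vector given by `(h, f, i) ↦ f h`; as
odd functions separate points of `Γ`, nontrivial elements of `Γ` move this vector far away in
Hamming distance (`exists_signed_action`). The set `S` is the `Γ`-orbit of the all-ones vector and of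
those vectors obtained from it by reversing the signs along an edge or a loop of a threshold graph
whose degrees are pairwise distinct. The translates of the all-ones vector are recognized in `S` by
Hamming distances, so modulo `Γ` a signed permutation preserving `S` fixes that vector; it then acts
as an automorphism of the threshold graph, so it is trivial (`exists_eq_of_preserves_signFamily`).
-/

/-! ### Faces of a polytope and its vertices -/

section PolytopeFaces

variable {E : Type*} [NormedAddCommGroup E] [NormedSpace ℝ E]

/-- An exposed face of a polytope is the convex hull of the given points lying on it. -/
theorem IsExposed.eq_convexHull_inter {V F : Set E} (hV : V.Finite)
    (hF : IsExposed ℝ (convexHull ℝ V) F) : F = convexHull ℝ (V ∩ F) := by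
  have hcomp : IsCompact (convexHull ℝ V) := hV.isCompact_convexHull ℝ
  have hFconv : Convex ℝ F := hF.convex (convex_convexHull ℝ V)
  refine Set.Subset.antisymm ?_ (convexHull_min Set.inter_subset_right hFconv)
  have hsub : F.extremePoints ℝ ⊆ V ∩ F := fun x hx =>
    ⟨extremePoints_convexHull_subset (𝕜 := ℝ)
      (hF.isExtreme.extremePoints_subset_extremePoints hx), hx.1⟩
  refine (closure_convexHull_extremePoints (hF.isCompact hcomp) hFconv).ge.trans ?_
  exact closure_minimal (convexHull_mono hsub)
    ((hV.subset Set.inter_subset_left).isClosed_convexHull ℝ)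

theorem IsExposed.eq_of_forall_mem_iff {V F F' : Set E} (hV : V.Finite)
    (hF : IsExposed ℝ (convexHull ℝ V) F) (hF' : IsExposed ℝ (convexHull ℝ V) F')
    (h : ∀ v ∈ V, v ∈ F ↔ v ∈ F') : F = F' := by
  have : V ∩ F = V ∩ F' := by
    ext v
    constructor
    · exact fun hv => ⟨hv.1, (h v hv.1).1 hv.2⟩
    · exact fun hv => ⟨hv.1, (h v hv.1).2 hv.2⟩
  rw [hF.eq_convexHull_inter hV, hF'.eq_convexHull_inter hV, this]

theorem IsExposed.exists_mem_of_nonempty {V F : Set E} (hV : V.Finite)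
    (hF : IsExposed ℝ (convexHull ℝ V) F) (hne : F.Nonempty) : ∃ v ∈ V, v ∈ F := by
  rw [hF.eq_convexHull_inter hV, convexHull_nonempty_iff] at hne
  obtain ⟨v, hv⟩ := hne
  exact ⟨v, hv.1, hv.2⟩

theorem le_of_mem_convexHull {V : Set E} {l : E →L[ℝ] ℝ} {M : ℝ} (h : ∀ w ∈ V, l w ≤ M) {x : E}
    (hx : x ∈ convexHull ℝ V) : l x ≤ M :=
  convexHull_min (t := {x | l x ≤ M}) h (convex_halfSpace_le l.isLinear M) hx

/-- A point of `V` at which some functional attains its strict maximum over `V` is a vertex of the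
convex hull of `V`. -/
theorem isExposed_singleton_of_forall_lt {V : Set E} (hV : V.Finite) {v : E} (hv : v ∈ V)
    (l : E →L[ℝ] ℝ) (hl : ∀ w ∈ V, w ≠ v → l w < l v) :
    IsExposed ℝ (convexHull ℝ V) {v} := by
  have hle : ∀ w ∈ V, l w ≤ l v := fun w hw => by
    by_cases h : w = v
    · rw [h]
    · exact (hl w hw h).le
  have hG : IsExposed ℝ (convexHull ℝ V)
      {x ∈ convexHull ℝ V | ∀ y ∈ convexHull ℝ V, l y ≤ l x} := fun _ => ⟨l, rfl⟩
  have : V ∩ {x ∈ convexHull ℝ V | ∀ y ∈ convexHull ℝ V, l y ≤ l x} = {v} := by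
    ext w
    constructor
    · rintro ⟨hw, -, hmax⟩
      by_contra hne
      exact absurd (hmax v (subset_convexHull ℝ V hv)) (not_le.2 (hl w hw hne))
    · rintro rfl
      exact ⟨hv, subset_convexHull ℝ V hv, fun y hy => le_of_mem_convexHull hle hy⟩
  have h2 := hG.eq_convexHull_inter hV
  rw [this, convexHull_singleton] at h2
  rwa [h2] at hG

/-- Two points are cofacial if some proper face contains both. -/
def Cofacial (P : Set E) (u v : E) : Prop :=
  ∃ F, IsExposed ℝ P F ∧ F ≠ P ∧ u ∈ F ∧ v ∈ F

theorem Cofacial.symm {P : Set E} {u v : E} (h : Cofacial P u v) : Cofacial P v u := by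
  obtain ⟨F, h1, h2, h3, h4⟩ := h
  exact ⟨F, h1, h2, h4, h3⟩

theorem cofacial_convexHull_iff {V : Set E} {u v : E} (hu : u ∈ V) (hv : v ∈ V) :
    Cofacial (convexHull ℝ V) u v ↔
      ∃ (l : E →L[ℝ] ℝ) (M : ℝ), (∀ w ∈ V, l w ≤ M) ∧ l u = M ∧ l v = M ∧ ∃ w ∈ V, l w < M := by
  have hsub := subset_convexHull ℝ V
  constructor
  · rintro ⟨F, hF, hne, huF, hvF⟩
    obtain ⟨l, rfl⟩ := hF ⟨u, huF⟩
    refine ⟨l, l u, fun w hw => huF.2 w (hsub hw), rfl,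
      le_antisymm (huF.2 v (hsub hv)) (hvF.2 u (hsub hu)), ?_⟩
    by_contra! hcon
    refine hne (Set.Subset.antisymm (Set.sep_subset _ _) fun x hx => ⟨hx, fun y hy => ?_⟩)
    have h1 : l y ≤ l u := huF.2 y hy
    have h2 : l u ≤ l x := by
      have := le_of_mem_convexHull (l := -l) (M := -l u)
        (fun w hw => neg_le_neg (hcon w hw)) hx
      simpa using this
    exact h1.trans h2
  · rintro ⟨l, M, hle, hlu, hlv, w, hw, hlt⟩
    refine ⟨{x ∈ convexHull ℝ V | ∀ y ∈ convexHull ℝ V, l y ≤ l x}, fun _ => ⟨l, rfl⟩, ?_,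
      ⟨hsub hu, fun y hy => ?_⟩, ⟨hsub hv, fun y hy => ?_⟩⟩
    · intro heq
      have := heq.symm ▸ hsub hw
      exact absurd (hlu ▸ this.2 u (hsub hu)) (not_le.2 hlt)
    · rw [hlu]; exact le_of_mem_convexHull hle hy
    · rw [hlv]; exact le_of_mem_convexHull hle hy

theorem CombSymmetry.nonempty_apply {P : Set E} (φ : CombSymmetry P) {F : FaceLattice P}
    (hF : F.1.Nonempty) : (φ F).1.Nonempty := by
  by_contra h
  rw [Set.not_nonempty_iff_eq_empty] at h
  have h1 : φ F ≤ φ ⟨∅, isExposed_empty⟩ := by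
    change (φ F).1 ⊆ _
    rw [h]
    exact Set.empty_subset _
  have h2 : F.1 ⊆ ∅ := (φ.le_iff_le).1 h1
  exact hF.ne_empty (Set.subset_empty_iff.1 h2)

theorem CombSymmetry.apply_ne {P : Set E} (φ : CombSymmetry P) {F : FaceLattice P}
    (hF : F.1 ≠ P) : (φ F).1 ≠ P := by
  intro h
  have h1 : φ ⟨P, IsExposed.refl P⟩ ≤ φ F := by
    change _ ⊆ (φ F).1
    rw [h]
    exact (φ _).2.subset
  exact hF (Set.Subset.antisymm F.2.subset ((φ.le_iff_le).1 h1))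

/-- A lattice automorphism permutes the vertices, these being the atoms of the face lattice. -/
theorem CombSymmetry.exists_vertex_map {V : Set E} (hV : V.Finite)
    (hexp : ∀ v ∈ V, IsExposed ℝ (convexHull ℝ V) {v}) (φ : CombSymmetry (convexHull ℝ V))
    {v : E} (hv : v ∈ V) :
    ∃ w ∈ V, ∀ F : FaceLattice (convexHull ℝ V), v ∈ F.1 ↔ w ∈ (φ F).1 := by
  let A : FaceLattice (convexHull ℝ V) := ⟨{v}, hexp v hv⟩
  obtain ⟨w, hw, hwA⟩ := (φ A).2.exists_mem_of_nonempty hV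
    (φ.nonempty_apply (Set.singleton_nonempty v))
  let B : FaceLattice (convexHull ℝ V) := ⟨{w}, hexp w hw⟩
  have hBA : B ≤ φ A := Set.singleton_subset_iff.2 hwA
  have hsub : φ.symm B ≤ A := by
    rw [← φ.le_iff_le, φ.apply_symm_apply]; exact hBA
  have hne : (φ.symm B).1.Nonempty :=
    CombSymmetry.nonempty_apply φ.symm (Set.singleton_nonempty w)
  have heq : φ.symm B = A := Subtype.ext ((hne.subset_singleton_iff).1 hsub)
  have hAB : φ A = B := by rw [← heq, φ.apply_symm_apply]
  refine ⟨w, hw, fun F => ?_⟩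
  have h1 : v ∈ F.1 ↔ A ≤ F := Set.singleton_subset_iff.symm
  have h2 : w ∈ (φ F).1 ↔ B ≤ φ F := Set.singleton_subset_iff.symm
  rw [h1, h2, ← hAB, φ.le_iff_le]

theorem CombSymmetry.cofacial_of {P : Set E} (φ : CombSymmetry P) {u v u' v' : E}
    (hu : ∀ F : FaceLattice P, u ∈ F.1 ↔ u' ∈ (φ F).1)
    (hv : ∀ F : FaceLattice P, v ∈ F.1 ↔ v' ∈ (φ F).1) (h : Cofacial P u v) :
    Cofacial P u' v' := by
  obtain ⟨F, hF, hne, huF, hvF⟩ := h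
  exact ⟨(φ ⟨F, hF⟩).1, (φ ⟨F, hF⟩).2, φ.apply_ne (F := ⟨F, hF⟩) hne,
    (hu ⟨F, hF⟩).1 huF, (hv ⟨F, hF⟩).1 hvF⟩

/-- The relation `∀ F, u ∈ F ↔ u' ∈ φ F` between vertices passes to the inverse automorphism. -/
theorem CombSymmetry.forall_mem_iff_symm {P : Set E} (φ : CombSymmetry P) {u u' : E}
    (hu : ∀ F : FaceLattice P, u ∈ F.1 ↔ u' ∈ (φ F).1) (F : FaceLattice P) :
    u' ∈ F.1 ↔ u ∈ (φ.symm F).1 := by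
  rw [hu, φ.apply_symm_apply]

end PolytopeFaces

/-! ### Signed indices -/

/-- The signed indices `±1, …, ±N`; they label the vertices of the cross-polytope. -/
abbrev SignedIndex (N : ℕ) : Type := Fin N × ℤˣ

/-- The opposite signed index. -/
def SignedIndex.opp {N : ℕ} (x : SignedIndex N) : SignedIndex N := (x.1, -x.2)

theorem SignedIndex.opp_opp {N : ℕ} (x : SignedIndex N) : opp (opp x) = x := by
  simp [opp]

theorem SignedIndex.opp_injective {N : ℕ} : Function.Injective (opp : SignedIndex N → _) :=
  Function.LeftInverse.injective opp_opp

theorem SignedIndex.opp_ne {N : ℕ} (x : SignedIndex N) : opp x ≠ x := by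
  intro h
  exact units_ne_neg_self x.2 (congrArg Prod.snd h).symm

/-! ### A family of sign vectors with prescribed symmetries -/

section SignFamily

open SignedIndex

variable {N : ℕ}

/-- The sign vector that is negative exactly at the indices in `A`, as an odd function of signed
indices. For empty `A`, the all-ones vector, this is the function `Prod.snd`. -/
def signFlip (A : Finset (Fin N)) (x : SignedIndex N) : ℤˣ :=
  if x.1 ∈ A then -x.2 else x.2

theorem signFlip_empty : signFlip (∅ : Finset (Fin N)) = Prod.snd := by
  funext x
  simp [signFlip]

theorem signFlip_opp (A : Finset (Fin N)) (x : SignedIndex N) :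
    signFlip A (opp x) = -signFlip A x := by
  unfold signFlip opp
  split_ifs <;> simp

theorem hammingDist_comp_equiv {ι α : Type*} [Fintype ι] [DecidableEq α] (s t : ι → α)
    (β : Equiv.Perm ι) : hammingDist (s ∘ β) (t ∘ β) = hammingDist s t := by
  unfold hammingDist
  refine Finset.card_bij (fun x _ => β x) ?_ ?_ ?_
  · intro x hx
    simpa using hx
  · intro x _ y _ h
    exact β.injective h
  · intro y hy
    exact ⟨β.symm y, by simpa using hy, by simp⟩

theorem hammingDist_signFlip (A B : Finset (Fin N)) :
    hammingDist (signFlip A) (signFlip B) = 2 * (symmDiff A B).card := by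
  have : (Finset.univ.filter fun x : SignedIndex N => signFlip A x ≠ signFlip B x) =
      symmDiff A B ×ˢ (Finset.univ : Finset ℤˣ) := by
    ext ⟨i, ε⟩
    rw [Finset.mem_filter, Finset.mem_product, Finset.mem_symmDiff]
    have h1 : ε ≠ -ε := units_ne_neg_self ε
    by_cases hA : i ∈ A <;> by_cases hB : i ∈ B <;>
      simp [signFlip, hA, hB, h1, h1.symm, Int.units_eq_one_or ε]
  unfold hammingDist
  rw [this, Finset.card_product]
  simp [mul_comm]

theorem signFlip_injective : Function.Injective (signFlip : Finset (Fin N) → _) := by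
  intro A B h
  have h1 := hammingDist_signFlip A B
  rw [h, hammingDist_self] at h1
  have : symmDiff A B = ∅ := Finset.card_eq_zero.1 (by omega)
  simpa using this

/-- The empty set together with the edges and loops `{i, j}` of a threshold graph in which, with
indices counted from zero, the index `i` has exactly `i + 1` neighbours. Since the degrees are
distinct the graph has no nontrivial automorphism. -/
def thresholdSets (N : ℕ) : Set (Finset (Fin N)) :=
  {A | A = ∅ ∨ ∃ i j : Fin N, N ≤ i + j + 1 ∧ A = {i, j}}

theorem card_le_two_of_mem_thresholdSets {A : Finset (Fin N)} (hA : A ∈ thresholdSets N) :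
    A.card ≤ 2 := by
  rcases hA with rfl | ⟨i, j, -, rfl⟩
  · simp
  · exact Finset.card_le_two

theorem le_of_pair_mem_thresholdSets {i j : Fin N} (h : {i, j} ∈ thresholdSets N) :
    N ≤ i + j + 1 := by
  rcases h with h | ⟨k, l, hkl, h⟩
  · simp at h
  · have hi : i = k ∨ i = l := by
      have : i ∈ ({k, l} : Finset (Fin N)) := h ▸ (by simp)
      simpa using this
    have hj : j = k ∨ j = l := by
      have : j ∈ ({k, l} : Finset (Fin N)) := h ▸ (by simp)
      simpa using this
    have hk : k = i ∨ k = j := by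
      have : k ∈ ({i, j} : Finset (Fin N)) := h ▸ (by simp)
      simpa using this
    have hl : l = i ∨ l = j := by
      have : l ∈ ({i, j} : Finset (Fin N)) := h ▸ (by simp)
      simpa using this
    grind

/-- Every nonempty set of the family is far from another one, while all are close to `∅`. -/
theorem exists_far_thresholdSet (hN : 7 ≤ N) {A : Finset (Fin N)} (hA : A ∈ thresholdSets N)
    (hne : A ≠ ∅) : ∃ B ∈ thresholdSets N, 3 ≤ (symmDiff A B).card := by
  rcases hA with rfl | ⟨i, j, -, rfl⟩
  · exact absurd rfl hne
  have hpick : ∀ k l : Fin N, k ≠ l → i ≠ k → i ≠ l → j ≠ k → j ≠ l →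
      N ≤ k + l + 1 → ∃ B ∈ thresholdSets N, 3 ≤ (symmDiff {i, j} B).card := by
    intro k l hkl h1 h2 h3 h4 hle
    refine ⟨{k, l}, Or.inr ⟨k, l, hle, rfl⟩, ?_⟩
    have hsub : ({i, k, l} : Finset (Fin N)) ⊆ symmDiff {i, j} {k, l} := by
      intro x hx
      simp only [Finset.mem_insert, Finset.mem_singleton] at hx
      rw [Finset.mem_symmDiff]
      simp only [Finset.mem_insert, Finset.mem_singleton]
      grind
    refine le_trans ?_ (Finset.card_le_card hsub)
    rw [Finset.card_eq_three.2 ⟨i, k, l, h1, h2, hkl, rfl⟩]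
  -- two of the last four indices avoid both `i` and `j`
  let a : Fin 4 → Fin N := fun c => ⟨N - 1 - c, by omega⟩
  have ha : Function.Injective a := by
    intro c d h
    have : N - 1 - (c : ℕ) = N - 1 - d := congrArg Fin.val h
    omega
  have hcard : 1 < (({i, j} : Finset (Fin N))ᶜ ∩ Finset.univ.image a).card := by
    have h1 : (Finset.univ.image a).card = 4 := by
      rw [Finset.card_image_of_injective _ ha]; simp
    have h2 : (Finset.univ.image a \ {i, j}).card + ({i, j} : Finset (Fin N)).card ≥ 4 := by
      have := Finset.le_card_sdiff ({i, j} : Finset (Fin N)) (Finset.univ.image a)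
      omega
    have h3 : ({i, j} : Finset (Fin N)).card ≤ 2 := Finset.card_le_two
    have h4 : ({i, j} : Finset (Fin N))ᶜ ∩ Finset.univ.image a = Finset.univ.image a \ {i, j} := by
      ext x; simp only [Finset.mem_inter, Finset.mem_compl, Finset.mem_sdiff]; tauto
    rw [h4]; omega
  obtain ⟨k, hk, l, hl, hkl⟩ := Finset.one_lt_card.1 hcard
  simp only [Finset.mem_inter, Finset.mem_compl, Finset.mem_insert, Finset.mem_singleton,
    Finset.mem_image, Finset.mem_univ, true_and, not_or] at hk hl
  obtain ⟨⟨hki, hkj⟩, c, rfl⟩ := hk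
  obtain ⟨⟨hli, hlj⟩, d, rfl⟩ := hl
  refine hpick _ _ hkl (Ne.symm hki) (Ne.symm hli) (Ne.symm hkj) (Ne.symm hlj) ?_
  have : (a c : ℕ) = N - 1 - c := rfl
  have : (a d : ℕ) = N - 1 - d := rfl
  omega

/-- The threshold graph is rigid: its degree at `i` is `i + 1`. -/
theorem eq_id_of_threshold_preserving {b : Fin N → Fin N} (hb : Function.Injective b)
    (h : ∀ i j : Fin N, N ≤ i + j + 1 → N ≤ b i + b j + 1) (i : Fin N) : b i = i := by
  have hdeg : ∀ i : Fin N, (Finset.univ.filter fun j : Fin N => N ≤ i + j + 1).card = i + 1 := by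
    intro i
    have : (Finset.univ.filter fun j : Fin N => N ≤ i + j + 1) =
        Finset.Ici (⟨N - 1 - i, by omega⟩ : Fin N) := by
      ext j
      simp only [Finset.mem_filter, Finset.mem_univ, true_and, Finset.mem_Ici, Fin.le_def]
      omega
    rw [this, Fin.card_Ici]
    simp only
    omega
  have hle : ∀ i, i ≤ b i := by
    intro i
    have h1 : (Finset.univ.filter fun j : Fin N => N ≤ i + j + 1).card ≤
        (Finset.univ.filter fun j : Fin N => N ≤ b i + j + 1).card :=
      Finset.card_le_card_of_injOn b (fun j hj => by simpa using h i j (by simpa using hj))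
        hb.injOn
    rw [hdeg, hdeg] at h1
    rw [Fin.le_def]
    omega
  have hsum : ∑ i : Fin N, (i : ℕ) = ∑ i, (b i : ℕ) :=
    ((Equiv.ofBijective b (Finite.injective_iff_bijective.1 hb)).sum_comp
      (fun i : Fin N => (i : ℕ))).symm
  exact Fin.ext ((Finset.sum_eq_sum_iff_of_le fun i _ => Fin.le_def.1 (hle i)).1 hsum i
    (Finset.mem_univ i)).symm

variable {Γ : Type*} [Group Γ]

/-- The sign vectors `signFlip A`, for `A` in the threshold family, and all their translates under
an action of `Γ` by signed permutations. -/
def signFamily (ρ : Γ →* Equiv.Perm (SignedIndex N)) : Set (SignedIndex N → ℤˣ) :=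
  {s | ∃ g, ∃ A ∈ thresholdSets N, s = signFlip A ∘ (ρ g).symm}

theorem comp_mem_signFamily {ρ : Γ →* Equiv.Perm (SignedIndex N)} (g : Γ)
    {s : SignedIndex N → ℤˣ} (hs : s ∈ signFamily ρ) : s ∘ (ρ g).symm ∈ signFamily ρ := by
  obtain ⟨h, A, hA, rfl⟩ := hs
  refine ⟨g * h, A, hA, ?_⟩
  rw [map_mul]
  rfl

theorem signFlip_mem_signFamily (ρ : Γ →* Equiv.Perm (SignedIndex N)) {A : Finset (Fin N)}
    (hA : A ∈ thresholdSets N) : signFlip A ∈ signFamily ρ :=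
  ⟨1, A, hA, by rw [map_one]; rfl⟩

variable {ρ : Γ →* Equiv.Perm (SignedIndex N)}

theorem nine_le_hammingDist_of_ne_one
    (hfar : ∀ g, g ≠ 1 → 13 ≤ hammingDist (Prod.snd : SignedIndex N → ℤˣ) (Prod.snd ∘ (ρ g).symm))
    {g : Γ} (hg : g ≠ 1) {A : Finset (Fin N)} (hA : A ∈ thresholdSets N) :
    9 ≤ hammingDist (Prod.snd : SignedIndex N → ℤˣ) (signFlip A ∘ (ρ g).symm) := by
  have h1 := hfar g hg
  have h2 := hammingDist_triangle (Prod.snd : SignedIndex N → ℤˣ) (signFlip A ∘ (ρ g).symm)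
    (Prod.snd ∘ (ρ g).symm)
  have h3 : hammingDist (signFlip A ∘ (ρ g).symm) (Prod.snd ∘ (ρ g).symm) ≤ 4 := by
    rw [hammingDist_comp_equiv, ← signFlip_empty, hammingDist_signFlip]
    have := card_le_two_of_mem_thresholdSets hA
    rw [← Finset.bot_eq_empty, symmDiff_bot]
    omega
  omega

theorem hammingDist_snd_signFlip_le {A : Finset (Fin N)} (hA : A ∈ thresholdSets N) :
    hammingDist (Prod.snd : SignedIndex N → ℤˣ) (signFlip A) ≤ 4 := by
  rw [← signFlip_empty, hammingDist_signFlip]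
  have := card_le_two_of_mem_thresholdSets hA
  rw [← Finset.bot_eq_empty, bot_symmDiff]
  omega

/-- Every signed permutation preserving the sign family carries `Prod.snd` to one of its translates:
these are the members of the family that have no other member at Hamming distance `5, …, 8`. -/
theorem exists_snd_comp_eq (hN : 7 ≤ N)
    (hfar : ∀ g, g ≠ 1 → 13 ≤ hammingDist (Prod.snd : SignedIndex N → ℤˣ) (Prod.snd ∘ (ρ g).symm))
    {β : Equiv.Perm (SignedIndex N)} (hβ : ∀ s ∈ signFamily ρ, s ∘ β.symm ∈ signFamily ρ) :
    ∃ g, (Prod.snd ∘ β.symm : SignedIndex N → ℤˣ) = Prod.snd ∘ (ρ g).symm := by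
  have hsurj : ∀ t ∈ signFamily ρ, ∃ s ∈ signFamily ρ, s ∘ β.symm = t := by
    have hfin : (signFamily ρ).Finite := Set.toFinite _
    have hinj : Set.InjOn (fun s : SignedIndex N → ℤˣ => s ∘ β.symm) (signFamily ρ) :=
      fun s _ t _ h => β.symm.surjective.injective_comp_right h
    have himg : (fun s : SignedIndex N → ℤˣ => s ∘ β.symm) '' signFamily ρ = signFamily ρ :=
      Set.eq_of_subset_of_ncard_le (Set.image_subset_iff.2 hβ) hinj.ncard_image.ge hfin
    exact fun t ht => himg.ge ht
  have hempty : (∅ : Finset (Fin N)) ∈ thresholdSets N := Or.inl rfl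
  obtain ⟨g, A, hA, hgA⟩ := hβ _ (signFlip_mem_signFamily ρ hempty)
  rw [signFlip_empty] at hgA
  refine ⟨g, ?_⟩
  by_cases hne : A = ∅
  · rw [hgA, hne, signFlip_empty]
  exfalso
  obtain ⟨B, hB, hAB⟩ := exists_far_thresholdSet hN hA hne
  obtain ⟨t, ht, htB⟩ := hsurj _ (⟨g, B, hB, rfl⟩ : signFlip B ∘ (ρ g).symm ∈ signFamily ρ)
  have hd : hammingDist (Prod.snd : SignedIndex N → ℤˣ) t = 2 * (symmDiff A B).card := by
    rw [← hammingDist_comp_equiv _ t β.symm, hgA, htB, hammingDist_comp_equiv,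
      hammingDist_signFlip]
  have hub : (symmDiff A B).card ≤ 4 := by
    have h1 := card_le_two_of_mem_thresholdSets hA
    have h2 := card_le_two_of_mem_thresholdSets hB
    have h3 := Finset.card_union_le A B
    have h4 := Finset.card_le_card (symmDiff_le_sup (a := A) (b := B))
    simp only [Finset.sup_eq_union] at h4
    omega
  obtain ⟨h, C, hC, rfl⟩ := ht
  by_cases h1 : h = 1
  · subst h1
    have : hammingDist (Prod.snd : SignedIndex N → ℤˣ) (signFlip C) ≤ 4 :=
      hammingDist_snd_signFlip_le hC
    rw [map_one] at hd
    change hammingDist (Prod.snd : SignedIndex N → ℤˣ) (signFlip C) = _ at hd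
    omega
  · have := nine_le_hammingDist_of_ne_one hfar h1 hC
    omega

/-- A signed permutation preserving the sign family and fixing `Prod.snd` acts on indices as an
automorphism of the threshold graph, hence trivially. -/
theorem eq_one_of_snd_comp_eq
    (hfar : ∀ g, g ≠ 1 → 13 ≤ hammingDist (Prod.snd : SignedIndex N → ℤˣ) (Prod.snd ∘ (ρ g).symm))
    {β : Equiv.Perm (SignedIndex N)} (hodd : ∀ x, β (opp x) = opp (β x))
    (hβ : ∀ s ∈ signFamily ρ, s ∘ β.symm ∈ signFamily ρ)
    (hsnd : (Prod.snd ∘ β.symm : SignedIndex N → ℤˣ) = Prod.snd) : β = 1 := by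
  have hsnd' : ∀ x, (β x).2 = x.2 := fun x => by
    have := congrFun hsnd (β x)
    simpa using this.symm
  set b : Fin N → Fin N := fun i => (β (i, 1)).1 with hbdef
  have hb : ∀ x, β x = (b x.1, x.2) := by
    rintro ⟨i, ε⟩
    have h1 : β (i, 1) = (b i, 1) := Prod.ext rfl (hsnd' _)
    rcases Int.units_eq_one_or ε with rfl | rfl
    · exact h1
    · have : ((i, -1) : SignedIndex N) = opp (i, 1) := rfl
      rw [this, hodd, h1]
      rfl
  have hbinj : Function.Injective b := by
    intro i j hij
    have : β (i, 1) = β (j, 1) := by rw [hb, hb]; simp [hij]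
    exact congrArg Prod.fst (β.injective this)
  have hpres : ∀ i j : Fin N, N ≤ i + j + 1 → N ≤ b i + b j + 1 := by
    intro i j hij
    have hA : {i, j} ∈ thresholdSets N := Or.inr ⟨i, j, hij, rfl⟩
    have himg : (signFlip {i, j} ∘ β.symm : SignedIndex N → ℤˣ) = signFlip {b i, b j} := by
      funext x
      obtain ⟨y, rfl⟩ := β.surjective x
      simp only [Function.comp_apply, Equiv.symm_apply_apply]
      rw [hb]
      simp [signFlip, hbinj.eq_iff]
    obtain ⟨h, C, hC, hCe⟩ := hβ _ (signFlip_mem_signFamily ρ hA)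
    have hh : h = 1 := by
      by_contra hne
      have h9 := nine_le_hammingDist_of_ne_one hfar hne hC
      have h4 := hammingDist_snd_signFlip_le hA
      rw [← hCe, ← hsnd, hammingDist_comp_equiv] at h9
      omega
    subst hh
    rw [map_one, himg] at hCe
    have : ({b i, b j} : Finset (Fin N)) = C := signFlip_injective hCe
    exact le_of_pair_mem_thresholdSets (this ▸ hC)
  ext x : 1
  rw [hb, eq_id_of_threshold_preserving hbinj hpres]
  rfl

/-- The signed permutations preserving the sign family are exactly those coming from `Γ`. -/
theorem exists_eq_of_preserves_signFamily (hN : 7 ≤ N)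
    (hρodd : ∀ g x, ρ g (opp x) = opp (ρ g x))
    (hfar : ∀ g, g ≠ 1 → 13 ≤ hammingDist (Prod.snd : SignedIndex N → ℤˣ) (Prod.snd ∘ (ρ g).symm))
    {β : Equiv.Perm (SignedIndex N)} (hodd : ∀ x, β (opp x) = opp (β x))
    (hβ : ∀ s ∈ signFamily ρ, s ∘ β.symm ∈ signFamily ρ) : ∃ g, β = ρ g := by
  obtain ⟨g, hg⟩ := exists_snd_comp_eq hN hfar hβ
  refine ⟨g, ?_⟩
  have h1 : ρ g⁻¹ * β = 1 := by
    refine eq_one_of_snd_comp_eq hfar (fun x => ?_) (fun s hs => ?_) ?_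
    · rw [Equiv.Perm.mul_apply, hodd, hρodd, Equiv.Perm.mul_apply]
    · exact comp_mem_signFamily g⁻¹ (hβ s hs)
    · change (Prod.snd ∘ β.symm) ∘ (ρ g⁻¹).symm = _
      rw [hg, map_inv]
      funext x
      exact congrArg Prod.snd ((ρ g).symm_apply_apply x)
  rw [map_inv] at h1
  exact (inv_mul_eq_one.1 h1).symm

end SignFamily

/-! ### The stacked cross-polytope -/

section StackedCross

open SignedIndex

variable {N : ℕ}

/-- The vertex of the standard cross-polytope labelled by a signed index: `± e_i`. -/
noncomputable def crossVertex (x : SignedIndex N) : EuclideanSpace ℝ (Fin N) :=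
  ((x.2 : ℤ) : ℝ) • EuclideanSpace.single x.1 (1 : ℝ)

/-- The apex placed over the facet of the cross-polytope with sign vector `s`. The sum runs over
signed indices, so that for odd `s` it is twice the sum of the vertices of the facet. The scaling
factor lies just above the value `1 / (2 * N)`, which would put the apex on the facet. -/
noncomputable def apex (s : SignedIndex N → ℤˣ) : EuclideanSpace ℝ (Fin N) :=
  (1 / (2 * N - 1) : ℝ) • ∑ x, ((s x : ℤ) : ℝ) • crossVertex x

/-- The vertices of the stacked cross-polytope: those of the cross-polytope, and the apexes over the
facets in `S`. -/
def stackedVertices (S : Set (SignedIndex N → ℤˣ)) : Set (EuclideanSpace ℝ (Fin N)) :=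
  Set.range crossVertex ∪ apex '' S

/-- The cross-polytope with a pyramid stacked on each facet in `S`. -/
def stackedCross (S : Set (SignedIndex N → ℤˣ)) : Set (EuclideanSpace ℝ (Fin N)) :=
  convexHull ℝ (stackedVertices S)

theorem crossVertex_mem (S : Set (SignedIndex N → ℤˣ)) (x : SignedIndex N) :
    crossVertex x ∈ stackedVertices S := Or.inl ⟨x, rfl⟩

theorem apex_mem {S : Set (SignedIndex N → ℤˣ)} {s : SignedIndex N → ℤˣ} (hs : s ∈ S) :
    apex s ∈ stackedVertices S := Or.inr ⟨s, hs, rfl⟩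

theorem finite_stackedVertices (S : Set (SignedIndex N → ℤˣ)) : (stackedVertices S).Finite :=
  (Set.finite_range _).union ((Set.toFinite S).image _)

theorem crossVertex_opp (x : SignedIndex N) : crossVertex (opp x) = -crossVertex x := by
  simp [crossVertex, opp]

theorem exists_functional {a : SignedIndex N → ℝ} (ha : ∀ x, a (opp x) = -a x) :
    ∃ l : EuclideanSpace ℝ (Fin N) →L[ℝ] ℝ, ∀ x, l (crossVertex x) = a x := by
  refine ⟨∑ i, a (i, 1) • EuclideanSpace.proj i, ?_⟩
  rintro ⟨j, ε⟩
  have h1 : (∑ i, a (i, 1) • EuclideanSpace.proj i : EuclideanSpace ℝ (Fin N) →L[ℝ] ℝ)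
      (crossVertex (j, ε)) = ((ε : ℤ) : ℝ) * a (j, 1) := by
    simp [crossVertex, mul_comm]
  rw [h1]
  rcases Int.units_eq_one_or ε with rfl | rfl
  · simp
  · have := ha (j, 1)
    change a (j, -1) = _ at this
    rw [this]; simp

theorem map_apex (l : EuclideanSpace ℝ (Fin N) →L[ℝ] ℝ) (s : SignedIndex N → ℤˣ) :
    l (apex s) = (∑ x, ((s x : ℤ) : ℝ) * l (crossVertex x)) / (2 * N - 1) := by
  simp [apex, map_sum, div_eq_inv_mul]

theorem sign_mul_sign (u : ℤˣ) : ((u : ℤ) : ℝ) * ((u : ℤ) : ℝ) = 1 := by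
  rcases Int.units_eq_one_or u with rfl | rfl <;> simp

theorem sign_mul_le_abs (u : ℤˣ) (r : ℝ) : ((u : ℤ) : ℝ) * r ≤ |r| := by
  rcases Int.units_eq_one_or u with rfl | rfl
  · simpa using le_abs_self r
  · simpa using neg_le_abs r

theorem sign_mul_sign_lt {u v : ℤˣ} (h : u ≠ v) : ((u : ℤ) : ℝ) * ((v : ℤ) : ℝ) < 1 := by
  rcases Int.units_eq_one_or u with rfl | rfl <;> rcases Int.units_eq_one_or v with rfl | rfl <;>
    first | exact absurd rfl h | norm_num

/-- A coordinate functional: it is `1` at one vertex of the cross-polytope, and small at all other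
vertices. -/
theorem exists_functional_cross (hN : 3 ≤ N) (x : SignedIndex N) :
    ∃ l : EuclideanSpace ℝ (Fin N) →L[ℝ] ℝ, l (crossVertex x) = 1 ∧
      l (crossVertex (opp x)) = -1 ∧ (∀ y, y ≠ x → l (crossVertex y) ≤ 0) ∧
      ∀ s, l (apex s) ≤ 1 / 2 := by
  have hne := opp_ne x
  obtain ⟨l, hl⟩ := exists_functional
    (a := fun y => if y = x then 1 else if y = opp x then -1 else 0) (fun y => by
      have h1 : opp y = x ↔ y = opp x :=
        ⟨fun h => by rw [← h, opp_opp], fun h => by rw [h, opp_opp]⟩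
      have h2 : opp y = opp x ↔ y = x := opp_injective.eq_iff
      simp only [h1, h2]
      by_cases hy : y = x
      · subst hy; simp [hne.symm]
      · by_cases hy' : y = opp x <;> simp [hy, hy', hne])
  have hN' : (3 : ℝ) ≤ N := by exact_mod_cast hN
  refine ⟨l, by simp [hl], by simp [hl, hne], fun y hy => ?_, fun s => ?_⟩
  · rw [hl]
    simp only [hy, if_false]
    split_ifs <;> norm_num
  · have hsum : ∑ y, |l (crossVertex y)| ≤ 2 := by
      have : ∀ y, |l (crossVertex y)| = (if y = x then 1 else 0) + if y = opp x then 1 else 0 := by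
        intro y
        rw [hl]
        by_cases hy : y = x
        · subst hy; simp [hne.symm]
        · by_cases hy' : y = opp x <;> simp [hy, hy', hne]
      simp only [this, Finset.sum_add_distrib, Finset.sum_ite_eq', Finset.mem_univ, if_true]
      norm_num
    rw [map_apex, div_le_iff₀ (by linarith)]
    have := Finset.sum_le_sum fun y (_ : y ∈ Finset.univ) =>
      sign_mul_le_abs (s y) (l (crossVertex y))
    linarith

theorem crossVertex_injective (hN : 3 ≤ N) :
    Function.Injective (crossVertex : SignedIndex N → _) := by
  intro x y h
  by_contra hne
  obtain ⟨l, h1, -, h3, -⟩ := exists_functional_cross hN x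
  have := h3 y (Ne.symm hne)
  rw [← h, h1] at this
  norm_num at this

theorem isExposed_crossVertex (hN : 3 ≤ N) (S : Set (SignedIndex N → ℤˣ)) (x : SignedIndex N) :
    IsExposed ℝ (stackedCross S) {crossVertex x} := by
  obtain ⟨l, h1, -, h3, h4⟩ := exists_functional_cross hN x
  refine isExposed_singleton_of_forall_lt (finite_stackedVertices S) (crossVertex_mem S x) l ?_
  rintro w (⟨y, rfl⟩ | ⟨s, -, rfl⟩) hw
  · have := h3 y (fun h => hw (by rw [h]))
    linarith
  · have := h4 s
    linarith

theorem isExposed_apex (hN : 3 ≤ N) {S : Set (SignedIndex N → ℤˣ)}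
    (hS : ∀ s ∈ S, ∀ x, s (opp x) = -s x) {s : SignedIndex N → ℤˣ} (hs : s ∈ S) :
    IsExposed ℝ (stackedCross S) {apex s} := by
  obtain ⟨l, hl⟩ := exists_functional (a := fun x => ((s x : ℤ) : ℝ)) (fun x => by
    simp [hS s hs x])
  have hN' : (3 : ℝ) ≤ N := by exact_mod_cast hN
  have hval : l (apex s) = 2 * N / (2 * N - 1) := by
    rw [map_apex]
    simp [hl, sign_mul_sign, mul_comm]
  refine isExposed_singleton_of_forall_lt (finite_stackedVertices S) (apex_mem hs) l ?_
  rintro w (⟨y, rfl⟩ | ⟨t, -, rfl⟩) hw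
  · rw [hval, hl, lt_div_iff₀ (by linarith)]
    rcases Int.units_eq_one_or (s y) with h | h <;> rw [h] <;> push_cast <;> linarith
  · have hne : t ≠ s := fun h => hw (by rw [h])
    obtain ⟨z, hz⟩ := Function.ne_iff.1 hne
    rw [map_apex, map_apex]
    refine div_lt_div_of_pos_right ?_ (by linarith)
    refine Finset.sum_lt_sum (fun x _ => ?_) ⟨z, Finset.mem_univ z, ?_⟩
    · rw [hl, sign_mul_sign]
      by_cases h : t x = s x
      · rw [h, sign_mul_sign]
      · exact (sign_mul_sign_lt h).le
    · rw [hl, sign_mul_sign]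
      exact sign_mul_sign_lt hz

theorem isExposed_of_mem_stackedVertices (hN : 3 ≤ N) {S : Set (SignedIndex N → ℤˣ)}
    (hS : ∀ s ∈ S, ∀ x, s (opp x) = -s x) :
    ∀ v ∈ stackedVertices S, IsExposed ℝ (stackedCross S) {v} := by
  rintro v (⟨x, rfl⟩ | ⟨s, hs, rfl⟩)
  · exact isExposed_crossVertex hN S x
  · exact isExposed_apex hN hS hs

/-- The maximum of a functional over the stacked cross-polytope is positive unless the functional
is constant there. -/
theorem pos_of_lt_max {S : Set (SignedIndex N → ℤˣ)} {l : EuclideanSpace ℝ (Fin N) →L[ℝ] ℝ} {M : ℝ}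
    (hle : ∀ w ∈ stackedVertices S, l w ≤ M) (hlt : ∃ w ∈ stackedVertices S, l w < M) : 0 < M := by
  by_contra! hM
  have h0 : ∀ x, l (crossVertex x) = 0 := fun x => by
    have h1 := hle _ (crossVertex_mem S x)
    have h2 := hle _ (crossVertex_mem S (opp x))
    rw [crossVertex_opp, map_neg] at h2
    linarith
  obtain ⟨w, (⟨x, rfl⟩ | ⟨s, -, rfl⟩), hw⟩ := hlt
  · rw [h0] at hw; linarith
  · rw [map_apex] at hw
    simp only [h0, mul_zero, Finset.sum_const_zero, zero_div] at hw
    linarith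

/-- A functional attaining its maximum `M` at the apex over the facet `s` is at least `M / 2` at all
vertices of that facet: the deficits from `M` at those vertices add up to `M / 2`. -/
theorem le_two_mul_of_map_apex_eq (hN : 3 ≤ N) {s : SignedIndex N → ℤˣ}
    (hs : ∀ x, s (opp x) = -s x) {l : EuclideanSpace ℝ (Fin N) →L[ℝ] ℝ} {M : ℝ}
    (hle : ∀ x, l (crossVertex x) ≤ M) (hM : l (apex s) = M) (x : SignedIndex N) :
    M ≤ 2 * (((s x : ℤ) : ℝ) * l (crossVertex x)) := by
  have hN' : (3 : ℝ) ≤ N := by exact_mod_cast hN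
  let t : SignedIndex N → ℝ := fun y => M - ((s y : ℤ) : ℝ) * l (crossVertex y)
  have htopp : t (opp x) = t x := by
    simp [t, hs, crossVertex_opp]
  have htnn : ∀ y, 0 ≤ t y := fun y => by
    rcases Int.units_eq_one_or (s y) with h | h
    · simpa [t, h] using hle y
    · have := hle (opp y)
      rw [crossVertex_opp, map_neg] at this
      simp only [t, h]
      push_cast
      linarith
  have hsum : ∑ y, t y = M := by
    rw [map_apex, div_eq_iff (by linarith)] at hM
    simp only [t, Finset.sum_sub_distrib, hM]
    simp
    ring
  have hpair : ∑ y ∈ {x, opp x}, t y ≤ ∑ y, t y := Finset.sum_le_univ_sum_of_nonneg htnn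
  rw [Finset.sum_pair (opp_ne x).symm, htopp, hsum] at hpair
  simp only [t] at hpair
  linarith

theorem cofacial_crossVertex_iff (hN : 3 ≤ N) (S : Set (SignedIndex N → ℤˣ))
    (x y : SignedIndex N) :
    Cofacial (stackedCross S) (crossVertex x) (crossVertex y) ↔ y ≠ opp x := by
  rw [stackedCross, cofacial_convexHull_iff (crossVertex_mem S x) (crossVertex_mem S y)]
  constructor
  · rintro ⟨l, M, hle, hx, hy, hlt⟩ rfl
    have := pos_of_lt_max hle hlt
    rw [crossVertex_opp, map_neg] at hy
    linarith
  · intro hne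
    obtain ⟨l, h1, h2, h3, h4⟩ := exists_functional_cross hN x
    by_cases hxy : y = x
    · subst hxy
      refine ⟨l, 1, ?_, h1, h1, crossVertex (opp y), crossVertex_mem S _, by rw [h2]; norm_num⟩
      rintro w (⟨z, rfl⟩ | ⟨s, -, rfl⟩)
      · by_cases hz : z = y
        · rw [hz, h1]
        · linarith [h3 z hz]
      · linarith [h4 s]
    obtain ⟨k, k1, k2, k3, k4⟩ := exists_functional_cross hN y
    have hxne : x ≠ opp y := fun h => hne (by rw [h, opp_opp])
    have hlk : ∀ {z}, z ≠ x → z ≠ opp x → l (crossVertex z) = 0 := fun {z} h h' => by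
      refine le_antisymm (h3 z h) ?_
      have := h3 (opp z) (fun e => h' (by rw [← e, opp_opp]))
      rw [crossVertex_opp, map_neg] at this
      linarith
    have hkl : ∀ {z}, z ≠ y → z ≠ opp y → k (crossVertex z) = 0 := fun {z} h h' => by
      refine le_antisymm (k3 z h) ?_
      have := k3 (opp z) (fun e => h' (by rw [← e, opp_opp]))
      rw [crossVertex_opp, map_neg] at this
      linarith
    refine ⟨l + k, 1, ?_, ?_, ?_, crossVertex (opp x), crossVertex_mem S _, ?_⟩
    · rintro w (⟨z, rfl⟩ | ⟨s, -, rfl⟩)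
      · change l _ + k _ ≤ 1
        by_cases hzx : z = x
        · subst hzx
          linarith [k3 z (Ne.symm hxy)]
        · by_cases hzy : z = y
          · subst hzy
            linarith [h3 z hzx]
          · linarith [h3 z hzx, k3 z hzy]
      · change l _ + k _ ≤ 1
        linarith [h4 s, k4 s]
    · change l _ + k _ = 1
      rw [h1, hkl (Ne.symm hxy) hxne, add_zero]
    · change l _ + k _ = 1
      rw [k1, hlk hxy hne, zero_add]
    · change l _ + k _ < 1
      linarith [k3 (opp x) (Ne.symm hne)]

theorem cofacial_apex_crossVertex_iff (hN : 3 ≤ N) {S : Set (SignedIndex N → ℤˣ)}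
    (hS : ∀ s ∈ S, ∀ x, s (opp x) = -s x) {s : SignedIndex N → ℤˣ} (hs : s ∈ S)
    (x : SignedIndex N) :
    Cofacial (stackedCross S) (apex s) (crossVertex x) ↔ s x = 1 := by
  rw [stackedCross, cofacial_convexHull_iff (apex_mem hs) (crossVertex_mem S x)]
  have hN' : (3 : ℝ) ≤ N := by exact_mod_cast hN
  constructor
  · rintro ⟨l, M, hle, hx, hy, hlt⟩
    have hM := pos_of_lt_max hle hlt
    have h1 := le_two_mul_of_map_apex_eq hN (hS s hs) (fun y => hle _ (crossVertex_mem S y)) hx x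
    rw [hy] at h1
    refine (Int.units_eq_one_or (s x)).resolve_right fun h => ?_
    rw [h] at h1
    push_cast at h1
    linarith
  · intro hx
    -- the weight `c` off `± x` is chosen so that the absolute values add up to `2 * N - 1`
    let c : ℝ := (2 * N - 3) / (2 * N - 2)
    have hc : (2 * N - 2) * c = 2 * N - 3 := mul_div_cancel₀ _ (by linarith)
    have hc0 : 0 < c := div_pos (by linarith) (by linarith)
    have hc1 : c ≤ 1 := (div_le_one (by linarith)).2 (by linarith)
    let m : SignedIndex N → ℝ := fun y => if y = x ∨ y = opp x then 1 else c
    have hm0 : ∀ y, 0 ≤ m y := fun y => by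
      simp only [m]; split_ifs <;> linarith
    have hm1 : ∀ y, m y ≤ 1 := fun y => by
      simp only [m]; split_ifs <;> linarith
    have hmsum : ∑ y, m y = 2 * N - 1 := by
      have h1 : ∀ y, m y = c + ((if y = x then 1 - c else 0) + if y = opp x then 1 - c else 0) := by
        intro y
        by_cases hy : y = x
        · subst hy; simp [m, (opp_ne y).symm]
        · by_cases hy' : y = opp x <;> simp [m, hy, hy', opp_ne x]
      simp only [h1, Finset.sum_add_distrib, Finset.sum_ite_eq', Finset.mem_univ, if_true]
      simp
      linarith
    obtain ⟨l, hl⟩ := exists_functional (a := fun y => ((s y : ℤ) : ℝ) * m y) (fun y => by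
      have h1 : opp y = x ↔ y = opp x :=
        ⟨fun h => by rw [← h, opp_opp], fun h => by rw [h, opp_opp]⟩
      have h2 : opp y = opp x ↔ y = x := opp_injective.eq_iff
      simp only [m, h1, h2, or_comm, hS s hs y]
      push_cast
      ring)
    have hlx : l (crossVertex x) = 1 := by simp [hl, hx, m]
    have hlabs : ∀ y, |l (crossVertex y)| = m y := fun y => by
      rw [hl, abs_mul, abs_of_nonneg (hm0 y)]
      rcases Int.units_eq_one_or (s y) with h | h <;> simp [h]
    refine ⟨l, 1, ?_, ?_, hlx, crossVertex (opp x), crossVertex_mem S _, ?_⟩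
    · rintro w (⟨y, rfl⟩ | ⟨t, -, rfl⟩)
      · exact (le_abs_self _).trans ((hlabs y).trans_le (hm1 y))
      · rw [map_apex, div_le_one (by linarith), ← hmsum]
        exact Finset.sum_le_sum fun y _ => (sign_mul_le_abs _ _).trans_eq (hlabs y)
    · rw [map_apex, div_eq_one_iff_eq (by linarith), ← hmsum]
      refine Finset.sum_congr rfl fun y _ => ?_
      rw [hl, ← mul_assoc, sign_mul_sign, one_mul]
    · rw [crossVertex_opp, map_neg, hlx]
      norm_num

theorem eq_of_cofacial_apex (hN : 3 ≤ N) {S : Set (SignedIndex N → ℤˣ)}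
    (hS : ∀ s ∈ S, ∀ x, s (opp x) = -s x) {s t : SignedIndex N → ℤˣ} (hs : s ∈ S) (ht : t ∈ S)
    (h : Cofacial (stackedCross S) (apex s) (apex t)) : s = t := by
  rw [stackedCross, cofacial_convexHull_iff (apex_mem hs) (apex_mem ht)] at h
  obtain ⟨l, M, hle, hx, hy, hlt⟩ := h
  have hM := pos_of_lt_max hle hlt
  funext x
  have h1 := le_two_mul_of_map_apex_eq hN (hS s hs) (fun y => hle _ (crossVertex_mem S y)) hx x
  have h2 := le_two_mul_of_map_apex_eq hN (hS t ht) (fun y => hle _ (crossVertex_mem S y)) hy x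
  rcases Int.units_eq_one_or (s x) with h | h <;> rcases Int.units_eq_one_or (t x) with h' | h' <;>
    rw [h] at h1 ⊢ <;> rw [h'] at h2 ⊢ <;> push_cast at h1 h2 <;> linarith

/-! ### Lattice automorphisms of the stacked cross-polytope -/

/-- Automorphisms of the face lattice carry vertices of the cross-polytope to such vertices, not to
apexes: the vertices cofacial with an apex are pairwise cofacial. -/
theorem exists_crossVertex_map (hN : 3 ≤ N) {S : Set (SignedIndex N → ℤˣ)}
    (hS : ∀ s ∈ S, ∀ x, s (opp x) = -s x) (φ : CombSymmetry (stackedCross S))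
    (x : SignedIndex N) :
    ∃ y, ∀ F : FaceLattice (stackedCross S), crossVertex x ∈ F.1 ↔ crossVertex y ∈ (φ F).1 := by
  have hV := finite_stackedVertices S
  have hexp := isExposed_of_mem_stackedVertices hN hS
  obtain ⟨w, (⟨y, rfl⟩ | ⟨s, hs, rfl⟩), hw⟩ :=
    CombSymmetry.exists_vertex_map hV hexp φ (crossVertex_mem S x)
  · exact ⟨y, hw⟩
  exfalso
  have hcof : ∀ u v, u ∈ stackedVertices S → v ∈ stackedVertices S →
      Cofacial (stackedCross S) (apex s) u → Cofacial (stackedCross S) (apex s) v →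
      Cofacial (stackedCross S) u v := by
    rintro u v (⟨a, rfl⟩ | ⟨t, ht, rfl⟩) hv hu hsv
    · obtain (⟨b, rfl⟩ | ⟨t, ht, rfl⟩) := hv
      · rw [cofacial_apex_crossVertex_iff hN hS hs] at hu hsv
        rw [cofacial_crossVertex_iff hN]
        rintro rfl
        rw [hS s hs, hu] at hsv
        exact absurd hsv (by decide)
      · rw [← eq_of_cofacial_apex hN hS hs ht hsv]
        exact hu.symm
    · rwa [← eq_of_cofacial_apex hN hS hs ht hu]
  obtain ⟨i, hi⟩ : ∃ i : Fin N, i ≠ x.1 := by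
    by_cases h : x.1 = ⟨0, by omega⟩
    · exact ⟨⟨1, by omega⟩, fun h' => by rw [h] at h'; simp at h'⟩
    · exact ⟨_, Ne.symm h⟩
  obtain ⟨u, hu, hu'⟩ := CombSymmetry.exists_vertex_map hV hexp φ (crossVertex_mem S (i, 1))
  obtain ⟨v, hv, hv'⟩ := CombSymmetry.exists_vertex_map hV hexp φ (crossVertex_mem S (i, -1))
  have h1 : Cofacial (stackedCross S) (apex s) u := CombSymmetry.cofacial_of φ hw hu'
    ((cofacial_crossVertex_iff hN S _ _).2 fun h => hi (congrArg Prod.fst h))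
  have h2 : Cofacial (stackedCross S) (apex s) v := CombSymmetry.cofacial_of φ hw hv'
    ((cofacial_crossVertex_iff hN S _ _).2 fun h => hi (congrArg Prod.fst h))
  have h3 : Cofacial (stackedCross S) (crossVertex (i, 1)) (crossVertex (i, -1)) :=
    CombSymmetry.cofacial_of φ.symm (CombSymmetry.forall_mem_iff_symm φ hu')
      (CombSymmetry.forall_mem_iff_symm φ hv') (hcof u v hu hv h1 h2)
  exact (cofacial_crossVertex_iff hN S _ _).1 h3 rfl

/-- Every automorphism of the face lattice is induced by a signed permutation preserving the family
of stacked facets. -/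
theorem exists_signedPerm (hN : 3 ≤ N) {S : Set (SignedIndex N → ℤˣ)}
    (hS : ∀ s ∈ S, ∀ x, s (opp x) = -s x) (φ : CombSymmetry (stackedCross S)) :
    ∃ β : Equiv.Perm (SignedIndex N), (∀ x, β (opp x) = opp (β x)) ∧
      (∀ x, ∀ F : FaceLattice (stackedCross S),
        crossVertex x ∈ F.1 ↔ crossVertex (β x) ∈ (φ F).1) ∧
      ∀ s ∈ S, s ∘ β.symm ∈ S ∧ ∀ F : FaceLattice (stackedCross S),
        apex s ∈ F.1 ↔ apex (s ∘ β.symm) ∈ (φ F).1 := by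
  have hV := finite_stackedVertices S
  have hexp := isExposed_of_mem_stackedVertices hN hS
  choose f hf using exists_crossVertex_map hN hS φ
  have hcof : ∀ x y, Cofacial (stackedCross S) (crossVertex (f x)) (crossVertex (f y)) →
      Cofacial (stackedCross S) (crossVertex x) (crossVertex y) := fun x y =>
    CombSymmetry.cofacial_of φ.symm (CombSymmetry.forall_mem_iff_symm φ (hf x))
      (CombSymmetry.forall_mem_iff_symm φ (hf y))
  have hinj : Function.Injective f := by
    intro x y hxy
    have h1 := (hf x ⟨_, isExposed_crossVertex hN S x⟩).1 (Set.mem_singleton _)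
    rw [hxy, ← hf y] at h1
    exact (crossVertex_injective hN h1).symm
  let β : Equiv.Perm (SignedIndex N) := Equiv.ofBijective f (Finite.injective_iff_bijective.1 hinj)
  have hodd : ∀ x, f (opp x) = opp (f x) := by
    intro x
    by_contra hne
    exact (cofacial_crossVertex_iff hN S _ _).1
      (hcof x (opp x) ((cofacial_crossVertex_iff hN S _ _).2 hne)) rfl
  refine ⟨β, hodd, hf, fun s hs => ?_⟩
  obtain ⟨w, hw, hwF⟩ := CombSymmetry.exists_vertex_map hV hexp φ (apex_mem hs)
  have hwF' := CombSymmetry.forall_mem_iff_symm φ hwF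
  obtain (⟨y, rfl⟩ | ⟨t, ht, rfl⟩) := hw
  · exfalso
    obtain ⟨x, rfl⟩ := β.surjective y
    have h1 := (hwF ⟨_, isExposed_apex hN hS hs⟩).1 (Set.mem_singleton _)
    have h2 : crossVertex x = apex s := (hf x ⟨_, isExposed_apex hN hS hs⟩).2 h1
    obtain ⟨l, h3, -, -, h4⟩ := exists_functional_cross hN x
    have h5 := h4 s
    rw [← h2, h3] at h5
    norm_num at h5
  · have hst : t = s ∘ β.symm := by
      funext z
      obtain ⟨x, rfl⟩ := β.surjective z
      rw [Function.comp_apply, Equiv.symm_apply_apply]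
      have h1 : s x = 1 ↔ t (f x) = 1 := by
        rw [← cofacial_apex_crossVertex_iff hN hS hs, ← cofacial_apex_crossVertex_iff hN hS ht]
        exact ⟨CombSymmetry.cofacial_of φ hwF (hf x), CombSymmetry.cofacial_of φ.symm hwF'
          (CombSymmetry.forall_mem_iff_symm φ (hf x))⟩
      change t (f x) = s x
      rcases Int.units_eq_one_or (s x) with h | h
      · rw [h, h1.1 h]
      · rw [h]
        exact (Int.units_eq_one_or _).resolve_left fun h' => by
          rw [h1.2 h'] at h
          exact absurd h (by decide)
    rw [← hst]
    exact ⟨ht, hwF⟩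

end StackedCross

/-! ### The action on signed indices -/

section Action

open SignedIndex

variable {Γ : Type*} [Group Γ]

/-- Odd sign functions on `Γ` separate `1` from every other element. -/
theorem exists_odd_function [Finite Γ] {σ : Γ} (hσσ : σ * σ = 1) (hσ1 : σ ≠ 1) {a : Γ}
    (ha : a ≠ 1) : ∃ f : Γ → ℤˣ, (∀ h, f (σ * h) = -f h) ∧ f 1 = 1 ∧ f a = -1 := by
  classical
  obtain ⟨n, ⟨e⟩⟩ := Finite.exists_equiv_fin Γ
  -- `f₀` marks the smaller element of each coset `{h, σ * h}`
  let f₀ : Γ → ℤˣ := fun h => if e h < e (σ * h) then 1 else -1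
  have hσh : ∀ h, σ * (σ * h) = h := fun h => by rw [← mul_assoc, hσσ, one_mul]
  have hf₀ : ∀ h, f₀ (σ * h) = -f₀ h := by
    intro h
    have hne : e h ≠ e (σ * h) := fun he => hσ1 (by simpa using e.injective he)
    simp only [f₀, hσh]
    rcases lt_or_gt_of_ne hne with h1 | h1
    · simp [h1, h1.le]
    · simp [h1, h1.not_gt]
  refine ⟨fun h => f₀ h * if h = 1 ∨ h = σ then f₀ 1 else -f₀ a, fun h => ?_, ?_, ?_⟩
  · have h1 : σ * h = 1 ↔ h = σ :=
      ⟨fun hh => by rw [← hσh h, hh, mul_one], fun hh => by rw [hh, hσσ]⟩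
    have h2 : σ * h = σ ↔ h = 1 := mul_eq_left
    simp only [h1, h2, hf₀, or_comm, neg_mul]
  · simp [Int.units_mul_self]
  · by_cases h : a = σ
    · subst h
      have := hf₀ 1
      rw [mul_one] at this
      simp [this, Int.units_mul_self]
    · simp [h, ha, Int.units_mul_self]

/-- A finite type with an involution and an odd sign function on it is the type of signed indices
up to equivalence: the elements of positive sign are the indices. -/
theorem exists_equiv_signedIndex {Y : Type*} [Finite Y] (τ : Y → Y) (hτ : ∀ y, τ (τ y) = y)
    (s : Y → ℤˣ) (hs : ∀ y, s (τ y) = -s y) :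
    ∃ (N : ℕ) (θ : Y ≃ SignedIndex N), (∀ y, (θ y).2 = s y) ∧ ∀ y, θ (τ y) = opp (θ y) := by
  classical
  obtain ⟨N, ⟨e⟩⟩ := Finite.exists_equiv_fin {y // s y = 1}
  have hneg : ∀ {y}, s y ≠ 1 → s (τ y) = 1 := fun {y} h => by
    rw [hs, (Int.units_eq_one_or _).resolve_left h, neg_neg]
  let p : Y → {y // s y = 1} := fun y => if h : s y = 1 then ⟨y, h⟩ else ⟨τ y, hneg h⟩
  have hp1 : ∀ {y}, s y = 1 → (p y : Y) = y := fun {y} h => by simp [p, h]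
  have hp2 : ∀ {y}, s y ≠ 1 → (p y : Y) = τ y := fun {y} h => by simp [p, h]
  have hpτ : ∀ y, p (τ y) = p y := by
    intro y
    apply Subtype.ext
    by_cases h : s y = 1
    · rw [hp1 h, hp2 (by rw [hs, h]; decide), hτ]
    · rw [hp2 h, hp1 (hneg h)]
  let f : Y → SignedIndex N := fun y => (e (p y), s y)
  have hf : Function.Bijective f := by
    constructor
    · intro y z hyz
      have h1 : p y = p z := e.injective (congrArg Prod.fst hyz)
      have h2 : s y = s z := congrArg Prod.snd hyz
      have h3 : (p y : Y) = p z := congrArg _ h1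
      by_cases h : s y = 1
      · rwa [hp1 h, hp1 (h2 ▸ h)] at h3
      · rw [hp2 h, hp2 (h2 ▸ h)] at h3
        rw [← hτ y, h3, hτ]
    · rintro ⟨i, ε⟩
      obtain ⟨⟨y, hy⟩, rfl⟩ := e.surjective i
      have hpy : p y = ⟨y, hy⟩ := Subtype.ext (hp1 hy)
      rcases Int.units_eq_one_or ε with rfl | rfl
      · exact ⟨y, by simp only [f, hpy, hy]⟩
      · exact ⟨τ y, by simp only [f, hpτ, hpy, hs, hy]⟩
  refine ⟨N, Equiv.ofBijective f hf, fun y => rfl, fun y => ?_⟩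
  change (e (p (τ y)), s (τ y)) = (e (p y), -s y)
  rw [hpτ, hs]

/-- A group with an involution `σ` acts on signed indices such that `σ` acts as `-1` and
all nontrivial elements move the all-ones sign vector far away. -/
theorem exists_signed_action [Finite Γ] {σ : Γ} (hσσ : σ * σ = 1) (hσ1 : σ ≠ 1) :
    ∃ (N : ℕ) (ρ : Γ →* Equiv.Perm (SignedIndex N)), (∀ x, ρ σ x = opp x) ∧
      ∀ g, g ≠ 1 → 13 ≤ hammingDist (Prod.snd : SignedIndex N → ℤˣ) (Prod.snd ∘ (ρ g).symm) := by
  classical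
  -- the thirteen copies make the distances large
  let Y : Type _ := Γ × ({f : Γ → ℤˣ // ∀ h, f (σ * h) = -f h} × Fin 13)
  let α : Γ →* Equiv.Perm Y :=
    { toFun := fun g => (Equiv.mulLeft g).prodCongr (Equiv.refl _)
      map_one' := Equiv.ext fun y => Prod.ext (one_mul _) rfl
      map_mul' := fun g h => Equiv.ext fun y => Prod.ext (mul_assoc _ _ _) rfl }
  have hα : ∀ g y, α g y = (g * y.1, y.2) := fun g y => rfl
  obtain ⟨N, θ, hθ1, hθ2⟩ := exists_equiv_signedIndex (Y := Y) (α σ)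
    (fun y => by rw [hα, hα, ← mul_assoc, hσσ, one_mul]) (fun y => y.2.1.1 y.1)
    (fun y => y.2.1.2 y.1)
  refine ⟨N, (θ.permCongrHom.toMonoidHom).comp α, fun x => ?_, fun g hg => ?_⟩
  · change θ (α σ (θ.symm x)) = _
    rw [hθ2, θ.apply_symm_apply]
  · obtain ⟨f, hodd, hf1, hfa⟩ := exists_odd_function hσσ hσ1 (inv_ne_one.2 hg)
    let k : Fin 13 → SignedIndex N := fun i => θ (1, ⟨f, hodd⟩, i)
    have hk : Function.Injective k := fun i j hij =>
      congrArg (fun y : Y => y.2.2) (θ.injective hij)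
    have hcard : (Finset.univ.image k).card = 13 := by
      rw [Finset.card_image_of_injective _ hk]; simp
    rw [← hcard]
    refine Finset.card_le_card fun x hx => ?_
    obtain ⟨i, -, rfl⟩ := Finset.mem_image.1 hx
    rw [Finset.mem_filter]
    refine ⟨Finset.mem_univ _, ?_⟩
    have h1 : (k i).2 = 1 := (hθ1 _).trans hf1
    have h2 : (θ ((α g).symm (θ.symm (k i)))).2 = -1 := by
      have h3 : θ.symm (k i) = (1, ⟨f, hodd⟩, i) := θ.symm_apply_apply _
      have h4 : (α g).symm (1, ⟨f, hodd⟩, i) = (g⁻¹, ⟨f, hodd⟩, i) := by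
        rw [Equiv.symm_apply_eq, hα]; simp
      rw [h3, h4, hθ1]
      exact hfa
    change (k i).2 ≠ (θ ((α g).symm (θ.symm (k i)))).2
    rw [h1, h2]
    decide

end Action

/-! ### Signed permutations as isometries -/

section Isometries

open SignedIndex

variable {N : ℕ}

theorem orthonormal_crossVertex_comp {β : Equiv.Perm (SignedIndex N)}
    (hβ : ∀ x, β (opp x) = opp (β x)) :
    Orthonormal ℝ fun i : Fin N => crossVertex (β (i, 1)) := by
  constructor
  · intro i
    rcases Int.units_eq_one_or (β (i, 1)).2 with h | h <;> simp [crossVertex, h]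
  · intro i j hij
    have hne : (β (i, 1)).1 ≠ (β (j, 1)).1 := by
      intro h
      rcases eq_or_ne (β (i, 1)).2 (β (j, 1)).2 with h2 | h2
      · exact hij (congrArg Prod.fst (β.injective (Prod.ext h h2)))
      · have h3 : β (i, 1) = β (opp (j, 1)) := by
          rw [hβ]
          refine Prod.ext h ?_
          exact (Int.units_ne_iff_eq_neg.1 h2)
        exact hij (congrArg Prod.fst (β.injective h3))
    simp [crossVertex, inner_smul_left, inner_smul_right, EuclideanSpace.inner_single_left, hne]

theorem exists_linearIsometryEquiv {β : Equiv.Perm (SignedIndex N)}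
    (hβ : ∀ x, β (opp x) = opp (β x)) :
    ∃ L : EuclideanSpace ℝ (Fin N) ≃ₗᵢ[ℝ] EuclideanSpace ℝ (Fin N),
      ∀ x, L (crossVertex x) = crossVertex (β x) := by
  obtain ⟨b, hb⟩ := Orthonormal.exists_orthonormalBasis_extension_of_card_eq
    (𝕜 := ℝ) (ι := Fin N) (E := EuclideanSpace ℝ (Fin N)) (by simp)
    (v := fun i => crossVertex (β (i, 1))) (s := Set.univ)
    ((orthonormal_crossVertex_comp hβ).comp _ Subtype.val_injective)
  refine ⟨(EuclideanSpace.basisFun (Fin N) ℝ).equiv b (Equiv.refl _), ?_⟩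
  have h1 : ∀ i, (EuclideanSpace.basisFun (Fin N) ℝ).equiv b (Equiv.refl _) (crossVertex (i, 1)) =
      crossVertex (β (i, 1)) := by
    intro i
    have : crossVertex (i, 1) = EuclideanSpace.basisFun (Fin N) ℝ i := by simp [crossVertex]
    rw [this, OrthonormalBasis.equiv_apply_basis, Equiv.refl_apply, hb i (Set.mem_univ i)]
  rintro ⟨i, ε⟩
  rcases Int.units_eq_one_or ε with rfl | rfl
  · exact h1 i
  · have : ((i, -1) : SignedIndex N) = opp (i, 1) := rfl
    rw [this, crossVertex_opp, map_neg, h1, hβ, crossVertex_opp]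

theorem linearIsometryEquiv_ext {L L' : EuclideanSpace ℝ (Fin N) ≃ₗᵢ[ℝ] EuclideanSpace ℝ (Fin N)}
    (h : ∀ x : SignedIndex N, L (crossVertex x) = L' (crossVertex x)) : L = L' := by
  apply LinearIsometryEquiv.toLinearEquiv_injective
  apply LinearEquiv.toLinearMap_injective
  refine (EuclideanSpace.basisFun (Fin N) ℝ).toBasis.ext fun i => ?_
  have : (EuclideanSpace.basisFun (Fin N) ℝ).toBasis i = crossVertex (i, 1) := by
    simp [crossVertex]
  rw [this]
  exact h (i, 1)

theorem map_apex_eq {β : Equiv.Perm (SignedIndex N)}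
    {L : EuclideanSpace ℝ (Fin N) ≃ₗᵢ[ℝ] EuclideanSpace ℝ (Fin N)}
    (hL : ∀ x, L (crossVertex x) = crossVertex (β x)) (s : SignedIndex N → ℤˣ) :
    L (apex s) = apex (s ∘ β.symm) := by
  simp only [apex, map_smul, map_sum, hL]
  congr 1
  rw [← Equiv.sum_comp β fun x => (((s ∘ β.symm) x : ℤ) : ℝ) • crossVertex x]
  simp

theorem toIsometryEquiv_mem_geomSymmetry {S : Set (SignedIndex N → ℤˣ)}
    {β : Equiv.Perm (SignedIndex N)} (hS : ∀ s, s ∈ S ↔ s ∘ β.symm ∈ S)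
    {L : EuclideanSpace ℝ (Fin N) ≃ₗᵢ[ℝ] EuclideanSpace ℝ (Fin N)}
    (hL : ∀ x, L (crossVertex x) = crossVertex (β x)) :
    L.toIsometryEquiv ∈ geomSymmetry (stackedCross S) := by
  change L '' _ = _
  have h1 : L '' stackedCross S = convexHull ℝ (L '' stackedVertices S) :=
    (L.toLinearEquiv.toLinearMap.image_convexHull (stackedVertices S))
  rw [h1, stackedCross, stackedVertices, Set.image_union]
  congr 2
  · rw [← Set.range_comp]
    have : L ∘ crossVertex = crossVertex ∘ β := funext hL
    rw [this, β.surjective.range_comp]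
  · ext v
    constructor
    · rintro ⟨_, ⟨s, hs, rfl⟩, rfl⟩
      exact ⟨_, (hS s).1 hs, (map_apex_eq hL s).symm⟩
    · rintro ⟨s, hs, rfl⟩
      have h2 : (s ∘ β) ∘ β.symm = s := by funext x; simp
      refine ⟨apex (s ∘ β), ⟨_, (hS _).2 (h2.symm ▸ hs), rfl⟩, ?_⟩
      rw [map_apex_eq hL, h2]

/-- A geometric symmetry acting trivially on the face lattice fixes all vertices, hence the origin
and everything else. -/
theorem geomToComb_stackedCross_injective (hN : 3 ≤ N) (S : Set (SignedIndex N → ℤˣ)) :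
    Function.Injective (geomToComb (stackedCross S)) := by
  rw [injective_iff_map_eq_one]
  intro g hg
  have hfix : ∀ x, g.1 (crossVertex x) = crossVertex x := by
    intro x
    have h1 : geomToComb (stackedCross S) g ⟨_, isExposed_crossVertex hN S x⟩ =
        ⟨_, isExposed_crossVertex hN S x⟩ := by rw [hg]; rfl
    have h2 : g.1 '' {crossVertex x} = {crossVertex x} := congrArg Subtype.val h1
    simpa using h2
  have h0 : g.1 0 = 0 := by
    have i : SignedIndex N := (⟨0, by omega⟩, 1)
    have h1 := g.1.map_midpoint (crossVertex i) (crossVertex (opp i))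
    rw [hfix, hfix, crossVertex_opp, midpoint_self_neg] at h1
    exact h1
  have h1 : g.1.toRealLinearIsometryEquivOfMapZero h0 = LinearIsometryEquiv.refl ℝ _ :=
    linearIsometryEquiv_ext hfix
  apply Subtype.ext
  ext v : 1
  exact congrArg (fun L => L v) h1

end Isometries

/-! ### The polytope of a group with a central involution -/

/-- `G(P) = Γ(P)` says that the natural map from geometric to combinatorial symmetries of `P` is an
isomorphism. -/
theorem theorem2p1 {Γ : Type*} [Group Γ] [Finite Γ] (σ : Γ)
    (hσ : σ ∈ Subgroup.center Γ) (hσ2 : orderOf σ = 2) :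
    ∃ (d : ℕ) (P : Set (EuclideanSpace ℝ (Fin d))),
      IsConvexPolytope P ∧ IsCentrallySymmetric P ∧
      Function.Bijective (geomToComb P) ∧
      ∃ e : Γ ≃* geomSymmetry P,
        ∀ x : EuclideanSpace ℝ (Fin d), (e σ).1 x = -x := by
  have hσσ : σ * σ = 1 := by rw [← pow_two, ← hσ2, pow_orderOf_eq_one]
  have hσ1 : σ ≠ 1 := fun h => by simp [h] at hσ2
  obtain ⟨N, ρ, hρσ, hfar⟩ := exists_signed_action hσσ hσ1
  have hN : 7 ≤ N := by
    have h1 := hfar σ hσ1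
    have h2 := hammingDist_le_card_fintype (x := (Prod.snd : SignedIndex N → ℤˣ))
      (y := Prod.snd ∘ (ρ σ).symm)
    simp at h2
    omega
  have hN3 : 3 ≤ N := by omega
  have hρodd : ∀ g x, ρ g (SignedIndex.opp x) = SignedIndex.opp (ρ g x) := fun g x => by
    rw [← hρσ, ← hρσ, ← Equiv.Perm.mul_apply, ← Equiv.Perm.mul_apply, ← map_mul, ← map_mul,
      Subgroup.mem_center_iff.1 hσ g]
  have hρsymm : ∀ g, (ρ g).symm = ρ g⁻¹ := fun g => by rw [map_inv]; rfl
  set S := signFamily ρ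
  have hS : ∀ s ∈ S, ∀ x, s (SignedIndex.opp x) = -s x := by
    rintro s ⟨g, A, -, rfl⟩ x
    simp only [Function.comp_apply, hρsymm, hρodd, signFlip_opp]
  have hSmem : ∀ g s, s ∈ S ↔ s ∘ (ρ g).symm ∈ S := fun g s =>
    ⟨comp_mem_signFamily g, fun h => by
      have := comp_mem_signFamily g⁻¹ h
      have h2 : (s ∘ (ρ g).symm) ∘ (ρ g⁻¹).symm = s := by
        rw [← hρsymm]
        funext x
        simp
      rwa [h2] at this⟩
  choose L hL using fun g => exists_linearIsometryEquiv (hρodd g)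
  let ψ : Γ →* geomSymmetry (stackedCross S) := MonoidHom.mk'
    (fun g => ⟨(L g).toIsometryEquiv, toIsometryEquiv_mem_geomSymmetry (hSmem g) (hL g)⟩)
    (fun g h => by
      have h1 : L (g * h) = (L h).trans (L g) := linearIsometryEquiv_ext fun x => by
        rw [LinearIsometryEquiv.trans_apply, hL, hL, hL, map_mul, Equiv.Perm.mul_apply]
      apply Subtype.ext
      ext v : 1
      exact congrArg (fun K => K v) h1)
  have hψ : ∀ g v, (ψ g).1 v = L g v := fun g v => rfl
  have hsurj : ∀ φ, ∃ g, geomToComb (stackedCross S) (ψ g) = φ := by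
    intro φ
    obtain ⟨β, hodd, hcross, hapex⟩ := exists_signedPerm hN3 hS φ
    obtain ⟨g, rfl⟩ := exists_eq_of_preserves_signFamily hN hρodd hfar hodd fun s hs =>
      (hapex s hs).1
    refine ⟨g, RelIso.ext fun F => Subtype.ext ?_⟩
    refine IsExposed.eq_of_forall_mem_iff (finite_stackedVertices S)
      (geomToComb (stackedCross S) (ψ g) F).2 (φ F).2 ?_
    have himg : ∀ v, L g v ∈ (geomToComb (stackedCross S) (ψ g) F).1 ↔ v ∈ F.1 := fun v =>
      (L g).injective.mem_set_image
    rintro v (⟨x, rfl⟩ | ⟨s, hs, rfl⟩)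
    · obtain ⟨y, rfl⟩ := (ρ g).surjective x
      rw [← hcross y F, ← hL, himg]
    · have h1 : (s ∘ ρ g) ∘ (ρ g).symm = s := by funext x; simp
      have h2 : s ∘ ρ g ∈ S := (hSmem g _).2 (h1.symm ▸ hs)
      have h3 := (hapex _ h2).2 F
      rw [h1] at h3
      rw [← h3, ← himg (apex (s ∘ ρ g)), map_apex_eq (hL g), h1]
  have hinj := geomToComb_stackedCross_injective hN3 S
  have hψinj : Function.Injective ψ := by
    rw [injective_iff_map_eq_one]
    intro g hg
    by_contra hne
    have h1 : ∀ x, ρ g x = x := fun x => crossVertex_injective hN3 <| by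
      rw [← hL, ← hψ, hg]
      rfl
    have h2 := hfar g hne
    have h3 : ρ g = 1 := Equiv.ext h1
    rw [h3] at h2
    change 13 ≤ hammingDist (Prod.snd : SignedIndex N → ℤˣ) Prod.snd at h2
    rw [hammingDist_self] at h2
    omega
  have hψsurj : Function.Surjective ψ := fun γ => by
    obtain ⟨g, hg⟩ := hsurj (geomToComb (stackedCross S) γ)
    exact ⟨g, hinj hg⟩
  have hneg : ∀ v, (ψ σ).1 v = -v := by
    have h1 : L σ = LinearIsometryEquiv.neg ℝ := linearIsometryEquiv_ext fun x => by
      rw [hL, hρσ, crossVertex_opp]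
      rfl
    intro v
    rw [hψ, h1]
    rfl
  refine ⟨N, stackedCross S, ⟨_, finite_stackedVertices S,
    ⟨_, crossVertex_mem S (⟨0, by omega⟩, 1)⟩, rfl⟩, ?_, ⟨hinj, fun φ => ?_⟩,
    MulEquiv.ofBijective ψ ⟨hψinj, hψsurj⟩, hneg⟩
  · have h1 : (ψ σ).1 '' stackedCross S = stackedCross S := (ψ σ).2
    unfold IsCentrallySymmetric
    rwa [← funext hneg]
  · obtain ⟨g, hg⟩ := hsurj φ
    exact ⟨ψ g, hg⟩
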